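/- For $m\in\mathbb{N}$ let $$\mathcal{A}_m(q)=\prod_{i=1}^m\bigl(1+q^{2i-1}\bigr)=\sum_{n=0}^{m^2}a_n q^n,$$ so that $a_n$ is the number of partitions of $n$ into distinct odd parts, each at most $2m-1$. Then, for all $m\ge 27$, the sequence $(a_{26},a_{27},\dots,a_{m^2-26})$ is symmetric and strictly unimodal. Here a finite sequence $(b_1,\dots,b_N)$ is called symmetric if $b_i=b_{N+1-i}$ for all $1\le i\le N$, and a symmetric sequence is called strictly unimodal if $$b_1<b_2<\dots<b_k=b_{k+1}>\dots>b_N\quad\text{when } N=2k,$$ $$b_1<b_2<\dots<b_k>b_{k+1}>\dots>b_N\quad\text{when } N=2k-1.$$ -/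

import Mathlib

open Polynomial

/-- The polynomial `∏_{i=1}^m (1 + q^(2i-1))`; every index satisfies `1 ≤ i`, so the natural-number
subtraction is exact. -/
noncomputable def oddProduct (m : ℕ) : ℕ[X] :=
  ∏ i ∈ Finset.Icc 1 m, (1 + X ^ (2 * i - 1))

/-- The coefficient `a_n` of `q^n` in `∏_{i=1}^m (1 + q^(2i-1))`. -/
noncomputable def oddCoeff (m n : ℕ) : ℕ := (oddProduct m).coeff n

/-- Partitions of `n` into pairwise distinct odd parts, each at most `2m - 1`. -/
def distinctOddPartitions (m n : ℕ) : Set n.Partition :=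
  {p | p.parts.Nodup ∧ ∀ i ∈ p.parts, Odd i ∧ i ≤ 2 * m - 1}

/-- The finite sequence `(a_s, a_{s+1}, …, a_t)` is symmetric: reversing it does not change it. -/
def IsSymmetricSeq (a : ℕ → ℕ) (s t : ℕ) : Prop :=
  ∀ i, s ≤ i → i ≤ t → a i = a (s + t - i)

/-- The finite sequence `(a_s, a_{s+1}, …, a_t)`, with centre `(s + t) / 2`, is symmetric and
strictly unimodal: strictly increasing up to the centre and strictly decreasing after it, where for
an even number of terms the two middle terms are equal. In terms of consecutive terms `a_i, a_{i+1}`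
of the sequence:
* `a_i < a_{i+1}` if `i + 1` is at most the centre;
* `a_i = a_{i+1}` if the centre lies halfway between `i` and `i + 1`;
* `a_i > a_{i+1}` if `i` is at least the centre. -/
def IsStrictlyUnimodalSeq (a : ℕ → ℕ) (s t : ℕ) : Prop :=
  IsSymmetricSeq a s t ∧
    ∀ i, s ≤ i → i + 1 ≤ t →
      (2 * (i + 1) ≤ s + t → a i < a (i + 1)) ∧
      (2 * i + 1 = s + t → a i = a (i + 1)) ∧
      (s + t ≤ 2 * i → a (i + 1) < a i)

/-! Let D_m(k) = a_k - a_{k-1}. By the symmetry of the product it is enough that D_m(k) > 0 for 27 ≤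
k ≤ m²/2 (`coeffDiff_pos`). The proof is by induction on m with D_{m+1}(k) = D_m(k) + D_m(k -
(2m+1)). If 2k ≤ m² + 1, the first term is nonnegative, and it vanishes at the antisymmetry centre
2k = m² + 1. The second is positive by induction, or has index at most 26, where D is explicit and
negative only at index 2; unrolling five more steps compensates that -1.

The recurrence does not settle the central window m² + 1 < 2k ≤ (m+1)². There the cases m + 1 < 200
are computed, and for m + 1 ≥ 200 a Fourier integral for D is bounded below
(`integral_pos_of_bounds`): its mass near 0 beats an exponentially small tail. -/

/-- The value of `oddProduct m` at `2 ^ B`, computed with shifts. -/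
def packedOddProduct (B : ℕ) : ℕ → ℕ
  | 0 => 1
  | m + 1 => packedOddProduct B m + packedOddProduct B m <<< (B * (2 * m + 1))

/-- The `k + 1` lowest base `b` digits of `N` increase strictly. -/
def digitsIncrease (b : ℕ) : ℕ → ℕ → Bool
  | 0, _ => true
  | k + 1, N => Nat.blt (N % b) (N / b % b) && digitsIncrease b k (N / b)

/-- The base `2 ^ B` digits of `N` with indices from `lo` to `hi` increase strictly. -/
def digitsIncreaseOn (B lo hi N : ℕ) : Bool :=
  digitsIncrease (2 ^ B) (hi - lo) (N >>> (B * lo) % 2 ^ (B * (hi - lo + 1)))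

/-- The start of the range in which `oddCoeff m` is compared by computation. -/
def checkStart (m : ℕ) : ℕ := bif Nat.ble m 32 then 26 else (m - 1) ^ 2 / 2

/-- The comparisons for the `f` values `m, m + 1, …`, with `N` the packed form of `oddProduct m`. -/
def checkFrom (B : ℕ) : ℕ → ℕ → ℕ → Bool
  | 0, _, _ => true
  | f + 1, m, N =>
    digitsIncreaseOn B (checkStart m) (m ^ 2 / 2) N &&
      checkFrom B f (m + 1) (N + N <<< (B * (2 * m + 1)))

-- Covers 27 ≤ m < 27 + 173 = 200. Base 2^200 avoids carries, since coefficients are at most 2^m.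
set_option maxRecDepth 100000 in
theorem checkFrom_eq_true : checkFrom 200 173 27 (packedOddProduct 200 27) = true := by
  decide +kernel

/-! ### Degree, and coefficients as counts of partitions -/

theorem oddProduct_zero : oddProduct 0 = 1 := by simp [oddProduct]

theorem oddProduct_succ (m : ℕ) : oddProduct (m + 1) = oddProduct m * (1 + X ^ (2 * m + 1)) := by
  rw [oddProduct, Finset.prod_Icc_succ_top (by omega)]
  rfl

theorem natDegree_oddProduct_le (m : ℕ) : (oddProduct m).natDegree ≤ m ^ 2 := by
  induction m with
  | zero => simp [oddProduct_zero]
  | succ m ih =>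
    rw [oddProduct_succ]
    refine natDegree_mul_le.trans ?_
    have : (1 + X ^ (2 * m + 1) : ℕ[X]).natDegree ≤ 2 * m + 1 :=
      natDegree_add_le_of_degree_le (by simp) (natDegree_X_pow_le _)
    nlinarith

theorem oddProduct_eq_sum (m : ℕ) :
    oddProduct m = ∑ n ∈ Finset.range (m ^ 2 + 1), C (oddCoeff m n) * X ^ n :=
  (oddProduct m).as_sum_range_C_mul_X_pow' (Nat.lt_succ_of_le (natDegree_oddProduct_le m))

theorem oddCoeff_eq_card (m n : ℕ) :
    oddCoeff m n =
      ((Finset.Icc 1 m).powerset.filter (fun t => ∑ i ∈ t, (2 * i - 1) = n)).card := by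
  rw [oddCoeff, oddProduct, Finset.prod_one_add, finsetSum_coeff, Finset.card_filter]
  refine Finset.sum_congr rfl fun t _ => ?_
  rw [Finset.prod_pow_eq_pow_sum, coeff_X_pow]
  exact if_congr eq_comm rfl rfl

theorem oddCoeff_eq_ncard (m n : ℕ) : oddCoeff m n = (distinctOddPartitions m n).ncard := by
  rw [oddCoeff_eq_card, ← Set.ncard_coe_finset]
  have mem : ∀ t ∈ (((Finset.Icc 1 m).powerset.filter
      (fun t => ∑ i ∈ t, (2 * i - 1) = n) : Finset (Finset ℕ)) : Set (Finset ℕ)),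
      (∀ i ∈ t, 1 ≤ i ∧ i ≤ m) ∧ ∑ i ∈ t, (2 * i - 1) = n := by
    intro t ht
    simp only [Finset.coe_filter, Finset.mem_powerset, Set.mem_ofPred_eq] at ht
    exact ⟨fun i hi => Finset.mem_Icc.1 (ht.1 hi), ht.2⟩
  -- Index sets and partitions correspond by i ↦ 2i - 1, with inverse j ↦ (j + 1) / 2 on odd j.
  refine Set.ncard_congr
    (fun t ht => ⟨t.val.map (fun i => 2 * i - 1), ?_, (mem t ht).2⟩) ?_ ?_ ?_
  · intro i hi
    obtain ⟨j, hj, rfl⟩ := Multiset.mem_map.1 hi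
    have := (mem t ht).1 j hj
    omega
  · intro t ht
    refine ⟨Multiset.Nodup.map_on ?_ t.nodup, ?_⟩
    · intro x hx y hy hxy
      have := (mem t ht).1 x hx
      have := (mem t ht).1 y hy
      omega
    · intro i hi
      obtain ⟨j, hj, rfl⟩ := Multiset.mem_map.1 hi
      have := (mem t ht).1 j hj
      exact ⟨⟨j - 1, by omega⟩, by omega⟩
  · intro s t hs ht h
    have key : ∀ u : Finset ℕ, (∀ i ∈ u, 1 ≤ i ∧ i ≤ m) →
        (u.val.map (fun i => 2 * i - 1)).map (fun i => (i + 1) / 2) = u.val := by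
      intro u hu
      rw [Multiset.map_map]
      conv_rhs => rw [← Multiset.map_id u.val]
      refine Multiset.map_congr rfl fun i hi => ?_
      have := hu i hi
      simp only [Function.comp_apply, id]
      omega
    have h' := congrArg (fun p : n.Partition => p.parts.map (fun i => (i + 1) / 2)) h
    simp only at h'
    rw [key s (mem s hs).1, key t (mem t ht).1] at h'
    exact Finset.val_injective h'
  · rintro p ⟨hp, hodd⟩
    have back : (p.parts.map (fun i => (i + 1) / 2)).map (fun i => 2 * i - 1) = p.parts := by
      rw [Multiset.map_map]
      conv_rhs => rw [← Multiset.map_id p.parts]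
      refine Multiset.map_congr rfl fun i hi => ?_
      obtain ⟨⟨j, rfl⟩, -⟩ := hodd i hi
      simp only [Function.comp_apply, id]
      omega
    refine ⟨⟨p.parts.map (fun i => (i + 1) / 2), ?_⟩, ?_, ?_⟩
    · refine Multiset.Nodup.of_map (fun i => 2 * i - 1) ?_
      rwa [back]
    · simp only [Finset.coe_filter, Finset.mem_powerset, Set.mem_ofPred_eq]
      refine ⟨fun i hi => ?_, ?_⟩
      · obtain ⟨j, hj, rfl⟩ := Multiset.mem_map.1 hi
        obtain ⟨⟨l, rfl⟩, hl⟩ := hodd j hj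
        rw [Finset.mem_Icc]
        omega
      · change (Multiset.map (fun i => 2 * i - 1) (p.parts.map (fun i => (i + 1) / 2))).sum = n
        rw [back, p.parts_sum]
    · ext1
      exact back

/-! ### Coefficient differences: recurrence and symmetry -/

/-- The coefficient of `q ^ k` in `oddProduct m` for an arbitrary integer `k`. -/
noncomputable def intCoeff (m : ℕ) (k : ℤ) : ℤ := if 0 ≤ k then (oddCoeff m k.toNat : ℤ) else 0

theorem intCoeff_natCast (m n : ℕ) : intCoeff m n = oddCoeff m n := by simp [intCoeff]

theorem intCoeff_of_neg (m : ℕ) {k : ℤ} (hk : k < 0) : intCoeff m k = 0 := by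
  simp [intCoeff, hk]

theorem intCoeff_zero (k : ℤ) : intCoeff 0 k = if k = 0 then 1 else 0 := by
  rcases lt_or_ge k 0 with hk | hk
  · rw [intCoeff_of_neg 0 hk, if_neg hk.ne]
  · lift k to ℕ using hk
    rw [intCoeff_natCast, oddCoeff, oddProduct_zero, coeff_one]
    simp

theorem intCoeff_succ (m : ℕ) (k : ℤ) :
    intCoeff (m + 1) k = intCoeff m k + intCoeff m (k - (2 * m + 1)) := by
  rcases lt_or_ge k 0 with hk | hk
  · rw [intCoeff_of_neg _ hk, intCoeff_of_neg _ hk, intCoeff_of_neg _ (by omega)]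
    rfl
  · lift k to ℕ using hk
    rw [intCoeff_natCast, intCoeff_natCast, oddCoeff, oddProduct_succ, mul_add, mul_one,
      coeff_add, coeff_mul_X_pow', oddCoeff]
    split_ifs with h
    · obtain ⟨j, rfl⟩ := Nat.exists_eq_add_of_le h
      rw [show ((2 * m + 1 + j : ℕ) : ℤ) - (2 * m + 1) = (j : ℕ) by push_cast; ring,
        intCoeff_natCast, oddCoeff, Nat.add_sub_cancel_left]
      push_cast
      rfl
    · rw [intCoeff_of_neg m (by omega)]
      simp

theorem intCoeff_symm (m : ℕ) (k : ℤ) : intCoeff m (m ^ 2 - k) = intCoeff m k := by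
  induction m generalizing k with
  | zero => simp [intCoeff_zero]
  | succ m ih =>
    rw [intCoeff_succ, intCoeff_succ, ← ih k, ← ih (k - (2 * m + 1)), add_comm]
    push_cast
    congr 2 <;> ring

/-- The difference of consecutive coefficients of `oddProduct m`. -/
noncomputable def coeffDiff (m : ℕ) (k : ℤ) : ℤ := intCoeff m k - intCoeff m (k - 1)

theorem coeffDiff_succ (m : ℕ) (k : ℤ) :
    coeffDiff (m + 1) k = coeffDiff m k + coeffDiff m (k - (2 * m + 1)) := by
  rw [coeffDiff, coeffDiff, coeffDiff, intCoeff_succ, intCoeff_succ,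
    show k - 1 - (2 * m + 1 : ℤ) = k - (2 * m + 1) - 1 by ring]
  ring

theorem coeffDiff_antisymm (m : ℕ) (k : ℤ) : coeffDiff m (m ^ 2 + 1 - k) = -coeffDiff m k := by
  rw [coeffDiff, coeffDiff, ← intCoeff_symm m k, ← intCoeff_symm m (k - 1),
    show (m : ℤ) ^ 2 + 1 - k - 1 = m ^ 2 - k by ring,
    show (m : ℤ) ^ 2 - (k - 1) = m ^ 2 + 1 - k by ring]
  ring

theorem coeffDiff_of_neg (m : ℕ) {k : ℤ} (hk : k < 0) : coeffDiff m k = 0 := by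
  rw [coeffDiff, intCoeff_of_neg _ hk, intCoeff_of_neg _ (by omega), sub_zero]

theorem coeffDiff_natCast_succ (m n : ℕ) :
    coeffDiff m ((n + 1 : ℕ) : ℤ) = oddCoeff m (n + 1) - oddCoeff m n := by
  rw [coeffDiff, intCoeff_natCast, show ((n + 1 : ℕ) : ℤ) - 1 = (n : ℕ) by push_cast; ring,
    intCoeff_natCast]

/-- Each later factor 1 + q^(2m+1) has 2m + 1 > 2M, so its shifted term has negative index. -/
theorem coeffDiff_stable {M m : ℕ} (hm : M ≤ m) {k : ℤ} (hk : k ≤ 2 * M) :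
    coeffDiff m k = coeffDiff M k := by
  induction m, hm using Nat.le_induction with
  | base => rfl
  | succ m hm ih => rw [coeffDiff_succ, ih, coeffDiff_of_neg m (by omega), add_zero]

/-! ### Comparing coefficients by means of a packed integer -/

theorem eval_div_pow_mod {b : ℕ} (p : ℕ[X]) (hp : ∀ n, p.coeff n < b) (k : ℕ) :
    p.eval b / b ^ k % b = p.coeff k := by
  have hb : 0 < b := (Nat.zero_le _).trans_lt (hp 0)
  induction k generalizing p with
  | zero =>
    conv_lhs => rw [← divX_mul_X_add p]
    simp only [eval_add, eval_mul, eval_X, eval_C, pow_zero, Nat.div_one, Nat.mul_add_mod_self_right]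
    exact Nat.mod_eq_of_lt (hp 0)
  | succ k ih =>
    have h : p.eval b / b = p.divX.eval b := by
      conv_lhs => rw [← divX_mul_X_add p]
      simp only [eval_add, eval_mul, eval_X, eval_C]
      rw [mul_comm, Nat.mul_add_div hb, Nat.div_eq_of_lt (hp 0), add_zero]
    rw [pow_succ', ← Nat.div_div_eq_div_mul, h, ih _ (fun n => by rw [coeff_divX]; exact hp _),
      coeff_divX]

theorem packedOddProduct_eq_eval (B m : ℕ) :
    packedOddProduct B m = (oddProduct m).eval (2 ^ B) := by
  induction m with
  | zero => simp [packedOddProduct, oddProduct_zero]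
  | succ m ih =>
    rw [packedOddProduct, oddProduct_succ, eval_mul, ← ih, Nat.shiftLeft_eq, pow_mul]
    simp only [eval_add, eval_one, eval_pow, eval_X]
    ring

theorem oddCoeff_le_two_pow (m n : ℕ) : oddCoeff m n ≤ 2 ^ m := by
  rw [oddCoeff_eq_card]
  refine (Finset.card_filter_le _ _).trans ?_
  simp

theorem oddCoeff_eq_digit {B m : ℕ} (h : m < B) (n : ℕ) :
    oddCoeff m n = packedOddProduct B m / (2 ^ B) ^ n % 2 ^ B := by
  rw [packedOddProduct_eq_eval, eval_div_pow_mod (oddProduct m) (b := 2 ^ B) fun n =>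
      (oddCoeff_le_two_pow m n).trans_lt (Nat.pow_lt_pow_right (by norm_num) h)]
  rfl

theorem lt_of_digitsIncrease {b k N : ℕ} (h : digitsIncrease b k N = true) {i : ℕ} (hi : i < k) :
    N / b ^ i % b < N / b ^ (i + 1) % b := by
  induction k generalizing N i with
  | zero => omega
  | succ k ih =>
    rw [digitsIncrease, Bool.and_eq_true, Nat.blt_eq] at h
    cases i with
    | zero => simpa using h.1
    | succ i =>
      have := ih h.2 (i := i) (by omega)
      rwa [Nat.div_div_eq_div_mul, Nat.div_div_eq_div_mul, ← pow_succ', ← pow_succ'] at this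

theorem mod_pow_div_pow_mod {b i k : ℕ} (N : ℕ) (h : i < k) :
    N % b ^ k / b ^ i % b = N / b ^ i % b := by
  obtain ⟨j, rfl⟩ := Nat.exists_eq_add_of_lt h
  rw [show i + j + 1 = i + (j + 1) by ring, pow_add, Nat.mod_mul_right_div_self]
  exact Nat.mod_mod_of_dvd _ (dvd_pow_self b (by omega))

theorem lt_of_digitsIncreaseOn {B lo hi N : ℕ} (h : digitsIncreaseOn B lo hi N = true) {n : ℕ}
    (h1 : lo ≤ n) (h2 : n < hi) :
    N / (2 ^ B) ^ n % 2 ^ B < N / (2 ^ B) ^ (n + 1) % 2 ^ B := by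
  obtain ⟨i, rfl⟩ := Nat.exists_eq_add_of_le h1
  have := lt_of_digitsIncrease h (i := i) (by omega)
  rw [pow_mul, mod_pow_div_pow_mod _ (by omega), mod_pow_div_pow_mod _ (by omega),
    Nat.shiftRight_eq_div_pow, Nat.div_div_eq_div_mul, Nat.div_div_eq_div_mul, pow_mul,
    ← pow_add, ← pow_add, ← add_assoc] at this
  exact this

theorem digitsIncreaseOn_of_checkFrom {B f m : ℕ} (h : checkFrom B f m (packedOddProduct B m) = true)
    {j : ℕ} (hj : j < f) :
    digitsIncreaseOn B (checkStart (m + j)) ((m + j) ^ 2 / 2) (packedOddProduct B (m + j)) = true := by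
  induction f generalizing m j with
  | zero => omega
  | succ f ih =>
    rw [checkFrom, Bool.and_eq_true] at h
    cases j with
    | zero => exact h.1
    | succ j =>
      have := ih (m := m + 1) h.2 (j := j) (by omega)
      rwa [show m + 1 + j = m + (j + 1) by ring] at this

theorem coeffDiff_pos_of_checked {m : ℕ} (h1 : 27 ≤ m) (h2 : m < 200) {k : ℤ}
    (hk : checkStart m < k) (hk' : 2 * k ≤ m ^ 2) : 0 < coeffDiff m k := by
  obtain ⟨n, rfl⟩ : ∃ n : ℕ, k = (n + 1 : ℕ) := ⟨(k - 1).toNat, by omega⟩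
  obtain ⟨j, rfl⟩ := Nat.exists_eq_add_of_le h1
  have h := lt_of_digitsIncreaseOn (digitsIncreaseOn_of_checkFrom checkFrom_eq_true (j := j)
    (by omega)) (n := n) (by omega)
    (by rw [← Nat.succ_le_iff, Nat.le_div_iff_mul_le two_pos]; zify; push_cast at hk' ⊢; linarith)
  rw [← oddCoeff_eq_digit h2, ← oddCoeff_eq_digit h2] at h
  rw [coeffDiff_natCast_succ]
  omega

theorem coeffDiff_eq_digits {m n : ℕ} (h : m < 200) :
    coeffDiff m ((n + 1 : ℕ) : ℤ) =
      (packedOddProduct 200 m / (2 ^ 200) ^ (n + 1) % 2 ^ 200 : ℕ) -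
      (packedOddProduct 200 m / (2 ^ 200) ^ n % 2 ^ 200 : ℕ) := by
  rw [coeffDiff_natCast_succ, oddCoeff_eq_digit h, oddCoeff_eq_digit h]

set_option maxRecDepth 100000 in
theorem packed_digits_initial : ∀ n < 26,
    (n ≠ 1 → packedOddProduct 200 27 / (2 ^ 200) ^ n % 2 ^ 200 ≤
      packedOddProduct 200 27 / (2 ^ 200) ^ (n + 1) % 2 ^ 200) ∧
    (packedOddProduct 200 27 / (2 ^ 200) ^ n % 2 ^ 200 ≤
      packedOddProduct 200 27 / (2 ^ 200) ^ (n + 1) % 2 ^ 200 + 1) ∧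
    (n = 7 ∨ n = 11 → packedOddProduct 200 27 / (2 ^ 200) ^ n % 2 ^ 200 <
      packedOddProduct 200 27 / (2 ^ 200) ^ (n + 1) % 2 ^ 200) := by
  decide +kernel

/-- By stability the values at m = 27 serve every larger m. The exception k = 2 comes from a_1 = 1,
a_2 = 0. -/
theorem coeffDiff_initial {m : ℕ} (hm : 27 ≤ m) {k : ℤ} (hk : k ≤ 26) :
    (k ≠ 2 → 0 ≤ coeffDiff m k) ∧ -1 ≤ coeffDiff m k ∧ (k = 8 ∨ k = 12 → 1 ≤ coeffDiff m k) := by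
  rcases lt_trichotomy k 0 with h | rfl | h
  · rw [coeffDiff_of_neg m h]
    omega
  · have : coeffDiff m 0 = intCoeff m 0 := by
      rw [coeffDiff, intCoeff_of_neg m (k := 0 - 1) (by norm_num), sub_zero]
    have h0 : 0 ≤ intCoeff m ((0 : ℕ) : ℤ) := by rw [intCoeff_natCast]; positivity
    rw [this]
    norm_num at h0 ⊢
    omega
  · rw [coeffDiff_stable hm (k := k) (by push_cast; omega)]
    obtain ⟨n, rfl⟩ : ∃ n : ℕ, k = (n + 1 : ℕ) := ⟨(k - 1).toNat, by omega⟩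
    have := packed_digits_initial n (by omega)
    rw [coeffDiff_eq_digits (by norm_num)]
    generalize packedOddProduct 200 27 / (2 ^ 200) ^ n % 2 ^ 200 = x at *
    generalize packedOddProduct 200 27 / (2 ^ 200) ^ (n + 1) % 2 ^ 200 = y at *
    omega

/-! ### Integral representation of the differences -/

section Analysis

open Real

theorem integral_cos_two_mul_int (k : ℤ) :
    ∫ x in (0 : ℝ)..(π / 2), cos (2 * k * x) = if k = 0 then π / 2 else 0 := by
  split_ifs with h
  · simp [h]
  · have hk : (2 * k : ℝ) ≠ 0 := by positivity
    rw [intervalIntegral.integral_comp_mul_left (fun x => cos x) hk, integral_cos,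
      show (2 * k : ℝ) * (π / 2) = k * π by ring]
    simp

theorem integral_prod_cos (m : ℕ) (k : ℤ) :
    ∫ x in (0 : ℝ)..(π / 2),
      (∏ i ∈ Finset.range m, (2 * cos ((2 * i + 1) * x))) * cos ((m ^ 2 - 2 * k) * x) =
    π / 2 * intCoeff m k := by
  induction m generalizing k with
  | zero =>
    have := integral_cos_two_mul_int (-k)
    simp only [Finset.range_zero, Finset.prod_empty, one_mul, intCoeff_zero]
    push_cast at this ⊢
    simp only [neg_eq_zero] at this
    convert this using 1
    · congr 1; ext x; congr 1; ring
    · split_ifs <;> simp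
  | succ m ih =>
    rw [intCoeff_succ]
    push_cast
    have h1 := ih k
    have h2 := ih (k - (2 * m + 1))
    rw [mul_add, ← h1, ← h2, ← intervalIntegral.integral_add]
    · congr 1
      ext x
      rw [Finset.prod_range_succ, ← mul_add]
      push_cast
      rw [show ((m : ℝ) ^ 2 - 2 * k) * x = ((m + 1) ^ 2 - 2 * k) * x - (2 * m + 1) * x by ring,
        show ((m : ℝ) ^ 2 - 2 * (k - (2 * m + 1))) * x
          = ((m + 1) ^ 2 - 2 * k) * x + (2 * m + 1) * x by ring, cos_sub, cos_add]
      ring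
    · exact Continuous.intervalIntegrable (by fun_prop) _ _
    · exact Continuous.intervalIntegrable (by fun_prop) _ _

theorem integral_prod_cos_mul_sin (m : ℕ) (k : ℤ) :
    2 * 2 ^ m * ∫ x in (0 : ℝ)..(π / 2),
      (∏ i ∈ Finset.range m, cos ((2 * i + 1) * x)) *
        (sin ((m ^ 2 - 2 * k + 1) * x) * sin x) =
    π / 2 * coeffDiff m k := by
  rw [coeffDiff]
  push_cast
  rw [mul_sub, ← integral_prod_cos, ← integral_prod_cos, ← intervalIntegral.integral_sub,
    ← intervalIntegral.integral_const_mul]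
  · congr 1
    ext x
    rw [Finset.prod_mul_distrib, Finset.prod_const, Finset.card_range, ← mul_sub]
    push_cast
    rw [show ((m : ℝ) ^ 2 - 2 * k) * x = (m ^ 2 - 2 * k + 1) * x - x by ring,
      show ((m : ℝ) ^ 2 - 2 * (k - 1)) * x = (m ^ 2 - 2 * k + 1) * x + x by ring, cos_sub, cos_add]
    ring
  · exact Continuous.intervalIntegrable (by fun_prop) _ _
  · exact Continuous.intervalIntegrable (by fun_prop) _ _

/-! ### Bounds for the product of cosines -/

theorem sum_sq_odd (m : ℕ) : ∑ i ∈ Finset.range m, (2 * i + 1 : ℝ) ^ 2 = m * (4 * m ^ 2 - 1) / 3 := by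
  induction m with
  | zero => simp
  | succ m ih =>
    rw [Finset.sum_range_succ, ih]
    push_cast
    ring

theorem one_sub_sum_le_prod_cos (m : ℕ) (y : ℕ → ℝ)
    (hy : ∀ i < m, 0 ≤ cos (y i)) :
    1 - ∑ i ∈ Finset.range m, y i ^ 2 / 2 ≤ ∏ i ∈ Finset.range m, cos (y i) := by
  induction m with
  | zero => simp
  | succ m ih =>
    rw [Finset.sum_range_succ, Finset.prod_range_succ]
    have h1 := ih fun i hi => hy i (by omega)
    have h2 : ∏ i ∈ Finset.range m, cos (y i) ≤ 1 :=
      Finset.prod_le_one (fun i hi => hy i (by rw [Finset.mem_range] at hi; omega))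
        fun i _ => cos_le_one _
    have h3 := one_sub_sq_div_two_le_cos (x := y m)
    have h4 : 0 ≤ ∏ i ∈ Finset.range m, cos (y i) :=
      Finset.prod_nonneg fun i hi => hy i (by rw [Finset.mem_range] at hi; omega)
    have h5 := cos_le_one (y m)
    nlinarith

theorem sin_two_mul_mul_sum_cos_sq (m : ℕ) (x : ℝ) :
    sin (2 * x) * ∑ i ∈ Finset.range m, cos ((2 * i + 1) * x) ^ 2 =
      m / 2 * sin (2 * x) + sin (4 * m * x) / 4 := by
  induction m with
  | zero => simp
  | succ m ih =>
    rw [Finset.sum_range_succ, mul_add, ih, cos_sq]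
    push_cast
    rw [show 4 * ((m : ℝ) + 1) * x = 2 * ((2 * m + 1) * x) + 2 * x by ring,
      show 4 * (m : ℝ) * x = 2 * ((2 * m + 1) * x) - 2 * x by ring, sin_add, sin_sub]
    ring

/-- A form of AM-GM, from t ≤ exp(t - 1) at t = y i / c. -/
theorem prod_le_pow_of_sum_le {m : ℕ} {c : ℝ} (hc : 0 < c) (y : ℕ → ℝ) (hy : ∀ i, 0 ≤ y i)
    (h : ∑ i ∈ Finset.range m, y i ≤ c * m) : ∏ i ∈ Finset.range m, y i ≤ c ^ m := by
  have h1 : ∏ i ∈ Finset.range m, y i / c ≤ ∏ i ∈ Finset.range m, exp (y i / c - 1) :=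
    Finset.prod_le_prod (fun i _ => div_nonneg (hy i) hc.le) fun i _ => by
      linarith [add_one_le_exp (y i / c - 1)]
  rw [← exp_sum, Finset.sum_sub_distrib, ← Finset.sum_div, Finset.prod_div_distrib] at h1
  simp only [Finset.prod_const, Finset.sum_const, Finset.card_range, nsmul_eq_mul, mul_one] at h1
  have h2 : (∑ i ∈ Finset.range m, y i) / c - m ≤ 0 := by
    rw [sub_nonpos, div_le_iff₀ hc, mul_comm]
    exact h
  have h3 := h1.trans (exp_le_one_iff.2 h2)
  rwa [div_le_one (by positivity)] at h3

theorem sum_cos_sq_le {m : ℕ} (hm : 1 ≤ m) {x : ℝ} (h1 : π / (4 * m) ≤ x) (h2 : x < π / 2) :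
    ∑ i ∈ Finset.range m, cos ((2 * i + 1) * x) ^ 2 ≤ 3 / 4 * m := by
  have hm' : (1 : ℝ) ≤ m := by exact_mod_cast hm
  have hβ : 0 < π / (4 * m) := by positivity
  have hs : 0 < sin (2 * x) := sin_pos_of_pos_of_lt_pi (by linarith) (by linarith)
  have key := sin_two_mul_mul_sum_cos_sq m x
  have hβm : 4 * m * (π / (4 * m)) = π := by field_simp
  rw [← mul_le_mul_iff_right₀ hs, key]
  -- Up to π/2 - π/(4m), Jordan's inequality gives m sin 2x ≥ 1; beyond it, sin 4mx ≤ 0.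
  suffices sin (4 * m * x) ≤ m * sin (2 * x) by nlinarith
  rcases le_or_gt x (π / 2 - π / (4 * m)) with h3 | h3
  · suffices 1 ≤ m * sin (2 * x) from (sin_le_one _).trans this
    have aux : ∀ y, π / (4 * m) ≤ y → y ≤ π / 4 → 1 ≤ m * sin (2 * y) := by
      intro y hy hy'
      have h4 := mul_le_sin (x := 2 * y) (by linarith) (by linarith)
      have h5 : 2 / π * (2 * (π / (4 * m))) * m = 1 := by field_simp; norm_num
      have h6 : 2 / π * (2 * (π / (4 * m))) ≤ sin (2 * y) := by
        refine le_trans ?_ h4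
        gcongr
      nlinarith
    rcases le_total x (π / 4) with h4 | h4
    · exact aux x h1 h4
    · have := aux (π / 2 - x) (by linarith) (by linarith)
      rwa [show 2 * (π / 2 - x) = π - 2 * x by ring, sin_pi_sub] at this
  · have h5 : sin (4 * m * x) ≤ 0 := by
      rw [show 4 * m * x = (m : ℕ) * (2 * π) - 4 * m * (π / 2 - x) by ring,
        sin_nat_mul_two_pi_sub, neg_nonpos]
      refine sin_nonneg_of_nonneg_of_le_pi (by have := sub_pos.2 h2; positivity) ?_
      nlinarith
    have : 0 ≤ m * sin (2 * x) := by positivity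
    linarith

theorem abs_prod_cos_le {m : ℕ} (hm : 1 ≤ m) {x : ℝ} (h1 : π / (4 * m) ≤ x) (h2 : x ≤ π / 2) :
    |∏ i ∈ Finset.range m, cos ((2 * i + 1) * x)| ≤ √((3 / 4) ^ m) := by
  rcases h2.lt_or_eq with h2 | rfl
  · refine abs_le_sqrt ?_
    rw [← Finset.prod_pow]
    exact prod_le_pow_of_sum_le (by norm_num) _ (fun i => sq_nonneg _) (sum_cos_sq_le hm h1 h2)
  · rw [Finset.prod_eq_zero (i := 0) (Finset.mem_range.2 hm) (by simp), abs_zero]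
    exact sqrt_nonneg _

theorem pow_nine_lt {m : ℕ} (hm : 200 ≤ m) : 900 * (m : ℝ) ^ 9 * (3 / 4) ^ m < 1 := by
  have h : 900 * m ^ 9 * 3 ^ m < 4 ^ m := by
    induction m, hm using Nat.le_induction with
    | base => norm_num
    | succ m hm ih =>
      have h1 : 3 * (m + 1) ^ 9 ≤ 4 * m ^ 9 := by
        have h2 : 200 * (m + 1) ≤ 201 * m := by omega
        have h3 := Nat.pow_le_pow_left h2 9
        rw [mul_pow, mul_pow] at h3
        norm_num at h3
        omega
      calc 900 * (m + 1) ^ 9 * 3 ^ (m + 1) = 900 * (3 * (m + 1) ^ 9) * 3 ^ m := by ring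
        _ ≤ 900 * (4 * m ^ 9) * 3 ^ m := by gcongr
        _ = 4 * (900 * m ^ 9 * 3 ^ m) := by ring
        _ < 4 * 4 ^ m := by omega
        _ = 4 ^ (m + 1) := by ring
  rw [div_pow, ← mul_div_assoc, div_lt_one (by positivity)]
  exact_mod_cast h

/-! ### Positivity of the integral for large m -/

theorem integral_pos_of_bounds {m : ℕ} (hm : 200 ≤ m) {s : ℝ} (hs : 1 ≤ s) (hs' : s ≤ 2 * m) :
    0 < ∫ x in (0 : ℝ)..(π / 2),
      (∏ i ∈ Finset.range m, cos ((2 * i + 1) * x)) * (sin (s * x) * sin x) := by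
  set G : ℝ → ℝ := fun x =>
    (∏ i ∈ Finset.range m, cos ((2 * i + 1) * x)) * (sin (s * x) * sin x) with hG
  have hint : ∀ a b, IntervalIntegrable G MeasureTheory.volume a b := fun a b =>
    Continuous.intervalIntegrable (by fun_prop) _ _
  have hm' : (200 : ℝ) ≤ m := by exact_mod_cast hm
  have hm0 : (0 : ℝ) < m := by linarith
  -- On [0, α], α = m^(-3/2), the product is at least 1 - (2/3) m³ x² ≥ 1/3.
  set α : ℝ := √(1 / m ^ 3) with hα
  have hα0 : 0 < α := by positivity
  have hα2 : α ^ 2 * m ^ 3 = 1 := by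
    rw [hα, sq_sqrt (by positivity)]
    field_simp
  -- Up to β all (2i+1)x and sx stay within π/2, so the integrand is nonnegative.
  set β : ℝ := π / (4 * m) with hβ
  have hβm : 4 * m * β = π := by rw [hβ]; field_simp
  have hβ0 : 0 < β := by positivity
  have hαβ : α ≤ β := by
    have h3 : (m * α) ^ 2 ≤ (1 / 2) ^ 2 := by
      have : (m * α) ^ 2 * m = 1 := by rw [← hα2]; ring
      nlinarith [sq_nonneg (m * α)]
    have h4 := le_of_abs_le (abs_le_of_sq_le_sq h3 (by norm_num))
    nlinarith [pi_gt_three]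
  have hβ2 : β ≤ π / 2 := by nlinarith [pi_pos]
  have hcos : ∀ x, 0 ≤ x → x ≤ β → ∀ i < m, 0 ≤ cos ((2 * i + 1) * x) := by
    intro x hx hx' i hi
    have hi' : (i : ℝ) + 1 ≤ m := by exact_mod_cast hi
    have : 0 ≤ (2 * i + 1) * x := by positivity
    exact cos_nonneg_of_neg_pi_div_two_le_of_le (by linarith [pi_pos]) (by nlinarith)
  have hsx : ∀ x, 0 ≤ x → x ≤ β → 2 / π * (s * x) ≤ sin (s * x) := fun x hx hx' =>
    mul_le_sin (by positivity) (by nlinarith)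
  have hx1 : ∀ x, 0 ≤ x → x ≤ β → 2 / π * x ≤ sin x := fun x hx hx' =>
    mul_le_sin hx (by linarith)
  have hlow : ∀ x ∈ Set.Icc 0 α, 1 / 3 * (4 / π ^ 2) * s * x ^ 2 ≤ G x := by
    rintro x ⟨h0, h1⟩
    have hP : 1 / 3 ≤ ∏ i ∈ Finset.range m, cos ((2 * i + 1) * x) := by
      refine le_trans ?_ (one_sub_sum_le_prod_cos m (fun i => (2 * i + 1) * x)
        (hcos x h0 (h1.trans hαβ)))
      simp only [mul_pow]
      rw [← Finset.sum_div, ← Finset.sum_mul, sum_sq_odd]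
      have : x ^ 2 * m ^ 3 ≤ 1 := by rw [← hα2]; gcongr
      nlinarith [sq_nonneg x]
    have e1 := hsx x h0 (h1.trans hαβ)
    have e2 := hx1 x h0 (h1.trans hαβ)
    calc 1 / 3 * (4 / π ^ 2) * s * x ^ 2 = 1 / 3 * ((2 / π * (s * x)) * (2 / π * x)) := by
          field_simp
          ring
      _ ≤ G x := by
          have : 0 ≤ 2 / π * (s * x) := by positivity
          have : 0 ≤ 2 / π * x := by positivity
          rw [hG]
          dsimp only
          gcongr
          linarith
  have hmid : ∀ x ∈ Set.Icc α β, 0 ≤ G x := by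
    rintro x ⟨h0, h1⟩
    have h0' := hα0.le.trans h0
    have : 0 ≤ 2 / π * (s * x) := by positivity
    have : 0 ≤ 2 / π * x := by positivity
    exact mul_nonneg (Finset.prod_nonneg fun i hi => hcos x h0' h1 i (Finset.mem_range.1 hi))
      (mul_nonneg (by linarith [hsx x h0' h1]) (by linarith [hx1 x h0' h1]))
  set τ : ℝ := √((3 / 4) ^ m) with hτ
  have htail : ∀ x ∈ Set.Icc β (π / 2), -(τ * (s * x)) ≤ G x := by
    rintro x ⟨h0, h1⟩
    have h0' := hβ0.le.trans h0
    refine neg_le_of_abs_le ?_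
    rw [hG]
    dsimp only
    rw [abs_mul, abs_mul]
    have e1 : |sin (s * x)| ≤ s * x := by
      refine abs_sin_le_abs.trans ?_
      rw [abs_of_nonneg (by positivity)]
    have e2 := abs_sin_le_one x
    have e3 := abs_prod_cos_le (by omega) h0 h1
    calc _ ≤ τ * (s * x * 1) := by gcongr
      _ = _ := by ring
  have i1 : 1 / 3 * (4 / π ^ 2) * s * (α ^ 3 / 3) ≤ ∫ x in (0 : ℝ)..α, G x := by
    have := intervalIntegral.integral_mono_on hα0.le
      (Continuous.intervalIntegrable (by fun_prop) _ _) (hint 0 α) hlow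
    rw [intervalIntegral.integral_const_mul, integral_pow] at this
    norm_num at this ⊢
    linarith
  have i2 : 0 ≤ ∫ x in α..β, G x := intervalIntegral.integral_nonneg hαβ hmid
  have i3 : -(τ * s * (π ^ 2 / 8)) ≤ ∫ x in β..(π / 2), G x := by
    have := intervalIntegral.integral_mono_on hβ2
      (Continuous.intervalIntegrable (by fun_prop) _ _) (hint β (π / 2)) htail
    rw [intervalIntegral.integral_neg, intervalIntegral.integral_const_mul,
      intervalIntegral.integral_const_mul, integral_id] at this
    refine le_trans ?_ this
    have hτ0 : 0 ≤ τ * s := by positivity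
    nlinarith [sq_nonneg β, mul_nonneg hτ0 (sq_nonneg β)]
  rw [← intervalIntegral.integral_add_adjacent_intervals (hint 0 α) (hint α (π / 2)),
    ← intervalIntegral.integral_add_adjacent_intervals (hint α β) (hint β (π / 2))]
  -- The main term wins if 9π⁴τ < 32α³; as π⁴ < 98, the factor 30 is enough.
  have hfinal : 30 * τ < α ^ 3 := by
    refine lt_of_pow_lt_pow_left₀ 2 (by positivity) ?_
    rw [mul_pow, hτ, sq_sqrt (by positivity), show (α ^ 3) ^ 2 = (α ^ 2) ^ 3 by ring, hα,
      sq_sqrt (by positivity), show (1 / (m : ℝ) ^ 3) ^ 3 = 1 / m ^ 9 by ring,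
      lt_div_iff₀ (by positivity)]
    have := pow_nine_lt hm
    nlinarith
  have hπ : π ^ 4 < 98 := by
    have h1 : π ^ 2 < 9.88 := by nlinarith [pi_lt_d4, pi_gt_three]
    nlinarith [sq_nonneg (π ^ 2)]
  have h9 : τ * (π ^ 2 / 8) < 1 / 3 * (4 / π ^ 2) * (α ^ 3 / 3) := by
    rw [show 1 / 3 * (4 / π ^ 2) * (α ^ 3 / 3) = 4 * α ^ 3 / 9 / π ^ 2 by field_simp; norm_num,
      lt_div_iff₀ (by positivity)]
    have : 0 ≤ τ := sqrt_nonneg _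
    nlinarith
  nlinarith

theorem coeffDiff_pos_of_central {m : ℕ} (hm : 200 ≤ m) {k : ℤ}
    (h1 : ((m : ℤ) - 1) ^ 2 + 1 < 2 * k) (h2 : 2 * k ≤ m ^ 2) : 0 < coeffDiff m k := by
  have h1' : ((m : ℝ) - 1) ^ 2 + 1 < 2 * k := by exact_mod_cast h1
  have h2' : 2 * (k : ℝ) ≤ m ^ 2 := by exact_mod_cast h2
  -- The window is exactly what puts this frequency between 1 and 2m.
  have h := integral_pos_of_bounds hm (s := m ^ 2 - 2 * k + 1) (by linarith) (by nlinarith)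
  have e := integral_prod_cos_mul_sin m k
  have : 0 < π / 2 * (coeffDiff m k : ℝ) := by rw [← e]; positivity
  exact_mod_cast pos_of_mul_pos_right this (by positivity)

end Analysis

/-! ### The induction on m -/

theorem coeffDiff_pos_of_window {m : ℕ} (hm : 33 ≤ m) {k : ℤ}
    (h1 : ((m : ℤ) - 1) ^ 2 + 1 < 2 * k) (h2 : 2 * k ≤ m ^ 2) : 0 < coeffDiff m k := by
  rcases lt_or_ge m 200 with h | h
  · refine coeffDiff_pos_of_checked (by omega) h ?_ h2
    have : checkStart m = (m - 1) ^ 2 / 2 := by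
      have hb : Nat.ble m 32 = false := by
        rw [← Bool.not_eq_true, Nat.ble_eq]
        omega
      rw [checkStart, hb]
      rfl
    rw [this]
    push_cast [Nat.cast_sub (show 1 ≤ m by omega)]
    omega
  · exact coeffDiff_pos_of_central h h1 h2

theorem coeffDiff_pos {m : ℕ} (hm : 27 ≤ m) {k : ℤ} (hk : 27 ≤ k) (hk' : 2 * k ≤ m ^ 2) :
    0 < coeffDiff m k := by
  induction m using Nat.strong_induction_on generalizing k with
  | _ m ih =>
  rcases le_or_gt m 32 with h | h
  · refine coeffDiff_pos_of_checked hm (by omega) ?_ hk'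
    rw [checkStart, Nat.ble_eq_true_of_le h]
    exact_mod_cast hk
  -- Six steps back must still be at least 27, so the cases up to 32 were computed in full.
  obtain ⟨m, rfl⟩ : ∃ l, m = l + 6 := ⟨m - 6, by omega⟩
  have hmz : (27 : ℤ) ≤ m := by omega
  push_cast at hk'
  rcases lt_or_ge ((m + 5 : ℤ) ^ 2 + 1) (2 * k) with hw | hw
  · exact coeffDiff_pos_of_window (by omega)
      (by rwa [show ((m + 6 : ℕ) : ℤ) - 1 = m + 5 by push_cast; ring]) (by push_cast; exact hk')
  have hrec := coeffDiff_succ (m + 5) k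
  push_cast at hrec
  rw [show m + 6 = m + 5 + 1 from rfl, hrec]
  have hlow : 0 ≤ coeffDiff (m + 5) k ∧ (2 * k ≤ (m + 5 : ℤ) ^ 2 → 0 < coeffDiff (m + 5) k) := by
    have hpos : 2 * k ≤ (m + 5 : ℤ) ^ 2 → 0 < coeffDiff (m + 5) k := fun h' =>
      ih (m + 5) (by omega) (by omega) hk (by push_cast; exact h')
    refine ⟨?_, hpos⟩
    rcases hw.lt_or_eq with hw | hw
    · exact (hpos (by omega)).le
    · have := coeffDiff_antisymm (m + 5) k
      push_cast at this
      rw [← hw, show 2 * k - k = k by ring] at this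
      omega
  rcases le_or_gt 27 (k - (2 * (m + 5) + 1)) with hj | hj
  · have := ih (m + 5) (by omega) (by omega) hj (by push_cast; nlinarith)
    linarith [hlow.1]
  · have hk2 := hlow.2 (by nlinarith)
    have hi := coeffDiff_initial (m := m + 5) (by omega) (k := k - (2 * (m + 5) + 1)) (by omega)
    by_cases h2 : k - (2 * (m + 5) + 1) = 2
    -- Positivity of D_{m+5}(k) alone only offsets the -1. Unrolled to D_m(k) ≥ 1, the shifts have
    -- indices 4, 6, 8, 10, 12, and index 12 adds at least 1.
    · obtain rfl : k = 2 * m + 13 := by linarith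
      have e1 := coeffDiff_succ (m + 4) (2 * m + 13)
      have e2 := coeffDiff_succ (m + 3) (2 * m + 13)
      have e3 := coeffDiff_succ (m + 2) (2 * m + 13)
      have e4 := coeffDiff_succ (m + 1) (2 * m + 13)
      have e5 := coeffDiff_succ m (2 * m + 13)
      push_cast at e1 e2 e3 e4 e5
      rw [show (2 * m + 13 - (2 * (m + 4) + 1) : ℤ) = 4 by ring] at e1
      rw [show (2 * m + 13 - (2 * (m + 3) + 1) : ℤ) = 6 by ring] at e2
      rw [show (2 * m + 13 - (2 * (m + 2) + 1) : ℤ) = 8 by ring] at e3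
      rw [show (2 * m + 13 - (2 * (m + 1) + 1) : ℤ) = 10 by ring] at e4
      rw [show (2 * m + 13 - (2 * m + 1) : ℤ) = 12 by ring] at e5
      have p := ih m (by omega) (by omega) (k := 2 * m + 13) (by omega) (by nlinarith)
      have i1 := (coeffDiff_initial (m := m + 4) (by omega) (k := 4) (by norm_num)).1 (by norm_num)
      have i2 := (coeffDiff_initial (m := m + 3) (by omega) (k := 6) (by norm_num)).1 (by norm_num)
      have i3 := (coeffDiff_initial (m := m + 2) (by omega) (k := 8) (by norm_num)).1 (by norm_num)
      have i4 := (coeffDiff_initial (m := m + 1) (by omega) (k := 10) (by norm_num)).1 (by norm_num)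
      have i5 := (coeffDiff_initial (m := m) (by omega) (k := 12) (by norm_num)).2.2 (by norm_num)
      linarith [hi.2.1]
    · linarith [hi.1 h2]

theorem oddCoeff_symm {m n : ℕ} (h : n ≤ m ^ 2) : oddCoeff m (m ^ 2 - n) = oddCoeff m n := by
  have := intCoeff_symm m n
  rw [show (m : ℤ) ^ 2 - n = (m ^ 2 - n : ℕ) by push_cast [Nat.cast_sub h]; ring,
    intCoeff_natCast, intCoeff_natCast] at this
  exact_mod_cast this

theorem oddCoeff_lt_succ {m n : ℕ} (hm : 27 ≤ m) (hn : 26 ≤ n) (h : 2 * (n + 1) ≤ m ^ 2) :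
    oddCoeff m n < oddCoeff m (n + 1) := by
  have := coeffDiff_pos hm (k := (n + 1 : ℕ)) (by omega) (by exact_mod_cast h)
  rw [coeffDiff_natCast_succ] at this
  omega

theorem theorem5p2 (m : ℕ) :
    (oddProduct m = ∑ n ∈ Finset.range (m ^ 2 + 1), C (oddCoeff m n) * X ^ n) ∧
    (∀ n : ℕ, oddCoeff m n = (distinctOddPartitions m n).ncard) ∧
    (27 ≤ m →
      IsSymmetricSeq (oddCoeff m) 26 (m ^ 2 - 26) ∧
      IsStrictlyUnimodalSeq (oddCoeff m) 26 (m ^ 2 - 26)) := by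
  refine ⟨oddProduct_eq_sum m, oddCoeff_eq_ncard m, fun hm => ?_⟩
  have hm2 : 27 ^ 2 ≤ m ^ 2 := Nat.pow_le_pow_left hm 2
  have hst : 26 + (m ^ 2 - 26) = m ^ 2 := by omega
  have hsymm : IsSymmetricSeq (oddCoeff m) 26 (m ^ 2 - 26) := fun i _ h => by
    rw [hst, oddCoeff_symm (by omega)]
  refine ⟨hsymm, hsymm, fun i h1 h2 => ?_⟩
  rw [hst]
  refine ⟨oddCoeff_lt_succ hm h1, fun h => ?_, fun h => ?_⟩
  · rw [← oddCoeff_symm (n := i) (by omega)]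
    congr 1
    omega
  · have := oddCoeff_lt_succ hm (n := m ^ 2 - (i + 1)) (by omega) (by omega)
    rwa [show m ^ 2 - (i + 1) + 1 = m ^ 2 - i by omega, oddCoeff_symm (by omega),
      oddCoeff_symm (by omega)] at this
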